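/- **Setting.** For finite sets of integers $D,E$ write $D\leq_{lex}E$ if there are $d\in D$, $e\in E$ with $d\le e$. For variables $U=\{u_1,\dots,u_n\}$, $V=\{v_1,\dots,v_n\}$ with finite integer domains, the intersection graph $\Gamma(U,V)$ is the bipartite graph on $U\cup V$ in which $u_i$ and $v_j$ are adjacent iff $Dom(u_i)\cap Dom(v_j)\neq\emptyset$. A *sort-matching* is a perfect matching $\sigma:V\to U$ of $\Gamma(U,V)$ such that the sets $Q_i=Dom(\sigma(v_i))\cap Dom(v_i)$ are non-empty and $Q_1\leq_{lex}Q_2\leq_{lex}\dots\leq_{lex}Q_n$ (i.e. $Q_i\leq_{lex}Q_{i+1}$ for $1\le i<n$). **Instance.** Let $H=H_1\wedge\dots\wedge H_k$ be an instance of Not-All-Equal 3SAT: each clause $H_i$ has three literals (repetitions allowed) from $x_1,\overline{x_1},\dots,x_p,\overline{x_p}$. Assume that for each $j$ the literal $x_j$ occurs in $H$ as many times as $\overline{x_j}$; let $occ(j)$ be the total number of positive and negative occurrences of $x_j$ (so $\sum_j occ(j)=3k$). **Construction.** For each $j$ fix an arbitrary ordering of the occurrences of $x_j$ in which positive and negative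 occurrences alternate, the first one being positive. To each occurrence associate a unit graph $G$, with vertices $a,b,c\in U$ and $a',b',c'\in V$; $G$ is positive or negative as the occurrence is. The unit graphs of $x_j$, in the chosen order, form the consistency component $CC_j$; a unit graph for an occurrence in $H_i$ belongs to the truth component $D_i$. For each clause $H_i$ there are also vertices $d_i,e_i\in U$ and $d'_i,e'_i\in V$. The order on $V$ is: the components $CC_1,\dots,CC_p$ in this order, the unit graphs of each in the chosen order, each one contributing $a',b',c'$ in this order; then $d'_1,\dots,d'_k$; then $e'_1,\dots,e'_k$. Thus $|U|=|V|=n=11k$. Let $t=24$, $m=3kt$, $q=m+2k$, and let $[l..r]$ denote an interval of integers. For $1\le i\le k$, $$Dom(d'_i)=[m+2i-1..m+2i],\qquad Dom(e'_i)=[q+2i-1..q+2i].$$ For a unit graph $G$ of an occurrence of $x_j$ in $H_i$, preceded by exactly $h$ unit graphs in the global order, the domains $A,B,C,A',B',C'$ of its vertices $a,b,c,a',b',c'$ are $$A=[ht+3..ht+6]\cup X,\quad B=[ht+9..ht+12],\quad C=[ht+15..ht+18]\cup T,$$ $$A'=[ht+7..ht+10]\cup Y,\quad B'=[ht+5..ht+8]\cup[ht+13..ht+16],\quad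 C'=[ht+11..ht+14]\cup Z,$$ where * if $G$ is positive: $X=Dom(d'_i)\cup Dom(e'_i)$, $T=\emptyset$, $Y=[ht+1..ht+2]$, $Z=[ht+21..ht+22]$; * if $G$ is negative: $T=Dom(d'_i)\cup Dom(e'_i)$, $Y=[ht-7..ht-4]$, $Z=[ht+23..ht+24]$, and $X=[(h+1)t+21..(h+1)t+22]$ if $G$ is not the last unit graph of $CC_j$, while $X=[(h+1-occ(j))t+21..(h+1-occ(j))t+22]$ if it is. Finally, $Dom(d_i)$ is the union of the sets $Y$ of the positive unit graphs and the sets $Z$ of the negative unit graphs of the occurrences in $H_i$, and $Dom(e_i)=Dom(d_i)\cup\bigcup_{s\ne i}Dom(e'_s)$. **Claim.** For every such $H$ and every choice of the alternating orderings, there is a truth assignment giving at least one true and at least one false literal in each clause of $H$ if and only if $\Gamma(U,V)$ has a sort-matching. -/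

import Mathlib

namespace SortSupport

/-! ### Intersection graphs and sort-matchings -/

section General

variable {ι κ : Type*}

/-- `D ≤_lex E`: some element of `D` is at most some element of `E`. -/
def LexLE (D E : Finset ℤ) : Prop := ∃ d ∈ D, ∃ e ∈ E, d ≤ e

/-- The intersection graph `Γ(U,V)`: the bipartite graph on the disjoint union of the two index
sets in which `u_i` and `v_j` are joined iff their domains meet. -/
def intersectionGraph (domU : ι → Finset ℤ) (domV : κ → Finset ℤ) : SimpleGraph (ι ⊕ κ) :=
  SimpleGraph.fromRel fun x y =>
    ∃ i j, x = Sum.inl i ∧ y = Sum.inr j ∧ (domU i ∩ domV j).Nonempty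

/-- `σ : V → U` is a perfect matching of a graph on `U ⊔ V`: it is injective, every `(σ v, v)` is
an edge, and every vertex of `U` is saturated (the vertices of `V` are, as `σ` is total). -/
def IsPerfectMatching (Γ : SimpleGraph (ι ⊕ κ)) (σ : κ → ι) : Prop :=
  Function.Injective σ ∧ (∀ v, Γ.Adj (Sum.inl (σ v)) (Sum.inr v)) ∧ Function.Surjective σ

/-- `Q_v = Dom(σ(v)) ∩ Dom(v)`. -/
def Q (domU : ι → Finset ℤ) (domV : κ → Finset ℤ) (σ : κ → ι) (v : κ) : Finset ℤ :=
  domU (σ v) ∩ domV v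

/-- A sort-matching of `Γ(U,V)`, `V = {v_0, …, v_{n-1}}`: a perfect matching all of whose sets
`Q_i` are nonempty, with `Q_0 ≤_lex Q_1 ≤_lex … ≤_lex Q_{n-1}`. -/
def IsSortMatching {n : ℕ} (domU domV : Fin n → Finset ℤ) (σ : Fin n → Fin n) : Prop :=
  IsPerfectMatching (intersectionGraph domU domV) σ ∧
  (∀ v, (Q domU domV σ v).Nonempty) ∧
  ∀ v w : Fin n, (v : ℕ) + 1 = (w : ℕ) → LexLE (Q domU domV σ v) (Q domU domV σ w)

/-- `Γ(U,V)` has a sort-matching. -/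
def HasSortMatching {n : ℕ} (domU domV : Fin n → Finset ℤ) : Prop :=
  ∃ σ : Fin n → Fin n, IsSortMatching domU domV σ

end General

/-! ### Not-All-Equal 3SAT -/

/-- An instance with `k` clauses over `p` boolean variables. Each clause has three literals
(repetitions are allowed); the literal `(j, true)` is `x_j`, and `(j, false)` is its negation. -/
structure Formula (k p : ℕ) where
  lit : Fin k → Fin 3 → Fin p × Bool

/-- The truth value of a literal under an assignment. -/
def litValue {p : ℕ} (τ : Fin p → Bool) (l : Fin p × Bool) : Bool :=
  if l.2 = true then τ l.1 else !(τ l.1)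

namespace Formula

variable {k p : ℕ} (H : Formula k p)

/-- Some assignment makes at least one literal true and at least one literal false in each
clause. -/
def NAESatisfiable : Prop :=
  ∃ τ : Fin p → Bool, ∀ i : Fin k,
    (∃ s, litValue τ (H.lit i s) = true) ∧ (∃ s, litValue τ (H.lit i s) = false)

/-- The occurrences (clause, place in the clause) of `x_j`, positive or negative. -/
def occurrences (j : Fin p) : Finset (Fin k × Fin 3) :=
  Finset.univ.filter fun o => (H.lit o.1 o.2).1 = j

/-- `occ(j)`. -/
def occ (j : Fin p) : ℕ := (H.occurrences j).card

/-- Each `x_j` occurs as many times positively as negatively. -/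
def Balanced : Prop :=
  ∀ j, ((H.occurrences j).filter fun o => (H.lit o.1 o.2).2 = true).card =
    ((H.occurrences j).filter fun o => (H.lit o.1 o.2).2 = false).card

/-- A choice, for every `j`, of an ordering of the occurrences of `x_j` in which positive and
negative ones alternate, starting with a positive one (places are counted from `0`). -/
structure AlternateOrder where
  seq : (j : Fin p) → Fin (H.occ j) ≃ {o // o ∈ H.occurrences j}
  alternates : ∀ (j : Fin p) (r : Fin (H.occ j)),
    (H.lit (seq j r).1.1 (seq j r).1.2).2 = true ↔ Even (r : ℕ)

/-- The unit graphs: `⟨j, r⟩` is the unit graph at place `r` (from `0`) of the consistency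
component `CC_j`. -/
abbrev UnitGraph : Type := Σ j : Fin p, Fin (H.occ j)

/-- The number of variables in `U`, and in `V` (that is, `11 k`): three for each unit graph and
two for each clause. -/
abbrev size : ℕ := (∑ j, H.occ j) * 3 + (k + k)

/-- The vertices of one side. On the side `U`: `inl (G, 0)`, `inl (G, 1)`, `inl (G, 2)` are the
vertices `a, b, c` of the unit graph `G`, while `inr (inl i)` is `d_i` and `inr (inr i)` is `e_i`.
On the side `V` the same codes stand for `a', b', c', d'_i, e'_i`. -/
abbrev Vertex : Type := (H.UnitGraph × Fin 3) ⊕ (Fin k ⊕ Fin k)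

/-- The global order on the vertices: first the unit graphs, component by component and in the
chosen order inside each component, each one contributing its `a`, `b`, `c` in this order; then all
the `d_i`; then all the `e_i`. -/
def index : H.Vertex ≃ Fin H.size :=
  (Equiv.sumCongr ((Equiv.prodCongr finSigmaFinEquiv (Equiv.refl (Fin 3))).trans finProdFinEquiv)
    finSumFinEquiv).trans finSumFinEquiv

variable {H}

/-- `h`: the number of unit graphs before `G` in the global order. -/
def UnitGraph.h (G : H.UnitGraph) : ℕ := (∑ q ∈ Finset.Iio G.1, H.occ q) + (G.2 : ℕ)

/-- `G` is the last unit graph of its consistency component. -/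
def UnitGraph.IsLast (G : H.UnitGraph) : Prop := (G.2 : ℕ) + 1 = H.occ G.1

instance (G : H.UnitGraph) : Decidable G.IsLast :=
  inferInstanceAs (Decidable ((G.2 : ℕ) + 1 = H.occ G.1))

end Formula

/-! ### The domains -/

noncomputable section

namespace Formula.AlternateOrder

open Formula

variable {k p : ℕ} {H : Formula k p} (S : H.AlternateOrder)

/-- The clause containing the occurrence represented by `G`. -/
def clause (G : H.UnitGraph) : Fin k := (S.seq G.1 G.2).1.1

/-- `G` represents a positive occurrence. -/
def IsPositive (G : H.UnitGraph) : Prop :=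
  (H.lit (S.seq G.1 G.2).1.1 (S.seq G.1 G.2).1.2).2 = true

instance (G : H.UnitGraph) : Decidable (S.IsPositive G) :=
  inferInstanceAs (Decidable (_ = true))

/-- The length of a block. -/
def t : ℤ := 24

/-- `m = 3kt`. -/
def m (k : ℕ) : ℤ := 3 * (k : ℤ) * t

/-- `q = m + 2k`. -/
def q (k : ℕ) : ℤ := m k + 2 * (k : ℤ)

/-- `Dom(d'_i) = [m+2i-1..m+2i]` with clauses numbered from `1`; the number of `i : Fin k` is
`i + 1`. -/
def domD' (i : Fin k) : Finset ℤ :=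
  Finset.Icc (m k + 2 * ((i : ℤ) + 1) - 1) (m k + 2 * ((i : ℤ) + 1))

/-- `Dom(e'_i) = [q+2i-1..q+2i]`, with the same numbering. -/
def domE' (i : Fin k) : Finset ℤ :=
  Finset.Icc (q k + 2 * ((i : ℤ) + 1) - 1) (q k + 2 * ((i : ℤ) + 1))

def X (G : H.UnitGraph) : Finset ℤ :=
  if S.IsPositive G then domD' (S.clause G) ∪ domE' (S.clause G)
  else if ¬ G.IsLast then
    Finset.Icc (((G.h : ℤ) + 1) * t + 21) (((G.h : ℤ) + 1) * t + 22)
  else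
    Finset.Icc (((G.h : ℤ) + 1 - (H.occ G.1 : ℤ)) * t + 21)
      (((G.h : ℤ) + 1 - (H.occ G.1 : ℤ)) * t + 22)

def T (G : H.UnitGraph) : Finset ℤ :=
  if S.IsPositive G then ∅ else domD' (S.clause G) ∪ domE' (S.clause G)

def Y (G : H.UnitGraph) : Finset ℤ :=
  if S.IsPositive G then Finset.Icc ((G.h : ℤ) * t + 1) ((G.h : ℤ) * t + 2)
  else Finset.Icc ((G.h : ℤ) * t - 7) ((G.h : ℤ) * t - 4)

def Z (G : H.UnitGraph) : Finset ℤ :=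
  if S.IsPositive G then Finset.Icc ((G.h : ℤ) * t + 21) ((G.h : ℤ) * t + 22)
  else Finset.Icc ((G.h : ℤ) * t + 23) ((G.h : ℤ) * t + 24)

def domA (G : H.UnitGraph) : Finset ℤ :=
  Finset.Icc ((G.h : ℤ) * t + 3) ((G.h : ℤ) * t + 6) ∪ S.X G

def domB (G : H.UnitGraph) : Finset ℤ :=
  Finset.Icc ((G.h : ℤ) * t + 9) ((G.h : ℤ) * t + 12)

def domC (G : H.UnitGraph) : Finset ℤ :=
  Finset.Icc ((G.h : ℤ) * t + 15) ((G.h : ℤ) * t + 18) ∪ S.T G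

def domA' (G : H.UnitGraph) : Finset ℤ :=
  Finset.Icc ((G.h : ℤ) * t + 7) ((G.h : ℤ) * t + 10) ∪ S.Y G

def domB' (G : H.UnitGraph) : Finset ℤ :=
  Finset.Icc ((G.h : ℤ) * t + 5) ((G.h : ℤ) * t + 8) ∪
    Finset.Icc ((G.h : ℤ) * t + 13) ((G.h : ℤ) * t + 16)

def domC' (G : H.UnitGraph) : Finset ℤ :=
  Finset.Icc ((G.h : ℤ) * t + 11) ((G.h : ℤ) * t + 14) ∪ S.Z G

/-- `Dom(d_i)`: the union of the `Y` of the positive and the `Z` of the negative unit graphs of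
clause `i`. -/
def domD (i : Fin k) : Finset ℤ :=
  ((Finset.univ.filter fun G : H.UnitGraph => S.clause G = i ∧ S.IsPositive G).biUnion S.Y) ∪
  ((Finset.univ.filter fun G : H.UnitGraph => S.clause G = i ∧ ¬ S.IsPositive G).biUnion S.Z)

/-- `Dom(e_i)`: in addition, the domains of all `e'_s` with `s ≠ i`. -/
def domE (i : Fin k) : Finset ℤ :=
  S.domD i ∪ (Finset.univ.filter fun s : Fin k => s ≠ i).biUnion domE'

/-- The domain of a vertex of `U`. -/
def vertexDomU : H.Vertex → Finset ℤ
  | Sum.inl (G, c) => ![S.domA G, domB G, S.domC G] c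
  | Sum.inr (Sum.inl i) => S.domD i
  | Sum.inr (Sum.inr i) => S.domE i

/-- The domain of a vertex of `V`. -/
def vertexDomV : H.Vertex → Finset ℤ
  | Sum.inl (G, c) => ![S.domA' G, domB' G, S.domC' G] c
  | Sum.inr (Sum.inl i) => domD' i
  | Sum.inr (Sum.inr i) => domE' i

/-- The domains of `U = {u_0, …, u_{n-1}}`. -/
def domU (n : Fin H.size) : Finset ℤ := S.vertexDomU (H.index.symm n)

/-- The domains of `V = {v_0, …, v_{n-1}}`, listed in the global order. -/
def domV (n : Fin H.size) : Finset ℤ := S.vertexDomV (H.index.symm n)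

end Formula.AlternateOrder

end

end SortSupport

/-!
The idea is that every unit graph has exactly two local states, that all unit graphs of one variable
share their state, and that the state of the variable is its truth value.

*States.* The vertex `b` is adjacent only to `a'` and `c'`, and `b'` only to `a` and `c`
(`edge_cases` lists all edges). Matching `b` with `a'` puts the common values near `ht + 9`, so the
order condition between `a'` and `b'` forbids the pair `a - b'` (values near `ht + 5`) and forces
`c - b'`; likewise `b - c'` forces `a - b'`. In the first state (true) `a` and `c'` remain free, in
the second one (false) `c` and `a'` do.

*Consistency.* From a positive unit graph to the next one there is only the edge `c - a'`, from a
negative one to its cyclic successor only `a - c'`. Either edge has both ends free or both ends used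
inside their unit graphs, so neighbouring states agree.

*Truth.* The remaining free vertex of a unit graph lies in `U` and is adjacent to `d'_i`, `e'_i` if
the literal is true; it lies in `V` and is adjacent to `d_i`, `e_i` if the literal is false. As
`d'_i` and `d_i` have no other neighbours, each clause has a true and a false literal
(`naeSatisfiable_of_hasSortMatching`).

Conversely, an assignment dictates the states; in each clause `d'_i` takes a true literal, `d_i` a
false one, and the third literal goes to `e'_i` or `e_i`. What is left over is `e_i` in the clauses
with two true literals and `e'_i` in those with two false ones. Since the formula is balanced, true
and false literals are equally many, so these clauses are equally many as well and can be paired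
(`exists_pairing`); the edges `e_i - e'_s`, `s ≠ i`, realise the pairing. The values
`matchingValue` witness the order condition.
-/

namespace SortSupport

open Formula

variable {k p : ℕ} {H : Formula k p}

/-! ### Positions in the global order -/

namespace Formula

theorem coe_finSigmaFinEquiv_eq_h (G : H.UnitGraph) :
    (finSigmaFinEquiv G : ℕ) = G.h := by
  rw [finSigmaFinEquiv_apply, UnitGraph.h]
  congr 1
  refine Finset.sum_bij (fun i _ => Fin.castLE G.1.2.le i) ?_ ?_ ?_ ?_
  · intro i _
    simp [Fin.lt_def]
  · intro i _ j _ hij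
    simpa using hij
  · intro q hq
    exact ⟨⟨q, by simpa using hq⟩, Finset.mem_univ _, rfl⟩
  · intros
    rfl

theorem UnitGraph.h_injective : Function.Injective (UnitGraph.h : H.UnitGraph → ℕ) := by
  intro G G' hG
  rw [← coe_finSigmaFinEquiv_eq_h, ← coe_finSigmaFinEquiv_eq_h] at hG
  exact finSigmaFinEquiv.injective (Fin.ext hG)

theorem sum_occ : ∑ j, H.occ j = 3 * k := by
  have := Finset.card_eq_sum_card_fiberwise (s := (Finset.univ : Finset (Fin k × Fin 3)))
    (t := Finset.univ) (f := fun o => (H.lit o.1 o.2).1) (by simp)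
  simp only [Finset.card_univ, Fintype.card_prod, Fintype.card_fin] at this
  rw [mul_comm, this]
  rfl

theorem UnitGraph.h_lt (G : H.UnitGraph) : G.h < 3 * k := by
  rw [← coe_finSigmaFinEquiv_eq_h, ← sum_occ (H := H)]
  exact (finSigmaFinEquiv G).2

theorem coe_index_unit (G : H.UnitGraph) (c : Fin 3) :
    (H.index (Sum.inl (G, c)) : ℕ) = c + 3 * G.h := by
  simp [index, ← coe_finSigmaFinEquiv_eq_h]

theorem coe_index_d (i : Fin k) :
    (H.index (Sum.inr (Sum.inl i)) : ℕ) = 3 * k * 3 + i := by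
  simp [index, ← sum_occ (H := H)]

theorem coe_index_e (i : Fin k) :
    (H.index (Sum.inr (Sum.inr i)) : ℕ) = 3 * k * 3 + (k + i) := by
  simp [index, ← sum_occ (H := H), add_comm]

/-! ### The cyclic order of a consistency component -/

/-- The cyclic successor of a unit graph within its consistency component: the last unit graph
is followed by the first one. -/
def next : H.UnitGraph ≃ H.UnitGraph :=
  Equiv.sigmaCongrRight fun j => finRotate (H.occ j)

@[simp] theorem next_fst (G : H.UnitGraph) : (next G).1 = G.1 := rfl

@[simp] theorem next_symm_fst (G : H.UnitGraph) : (next.symm G).1 = G.1 := rfl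

theorem next_snd (G : H.UnitGraph) :
    ((next G).2 : ℕ) = if G.IsLast then 0 else (G.2 : ℕ) + 1 := by
  obtain ⟨j, r⟩ := G
  change (finRotate (H.occ j) r : ℕ) = if (r : ℕ) + 1 = H.occ j then 0 else (r : ℕ) + 1
  generalize H.occ j = n at r
  obtain _ | n := n
  · exact r.elim0
  · rw [coe_finRotate]
    simp [Fin.ext_iff]

theorem h_next (G : H.UnitGraph) :
    ((next G).h : ℤ) = if G.IsLast then (G.h : ℤ) + 1 - H.occ G.1 else (G.h : ℤ) + 1 := by
  have h1 : (next G).h = (∑ q ∈ Finset.Iio G.1, H.occ q) + ((next G).2 : ℕ) := rfl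
  have h2 : G.h = (∑ q ∈ Finset.Iio G.1, H.occ q) + (G.2 : ℕ) := rfl
  rw [h1, h2, next_snd]
  split_ifs with hl
  · unfold UnitGraph.IsLast at hl
    omega
  · push_cast
    ring

theorem Balanced.even_occ (hH : H.Balanced) (j : Fin p) : Even (H.occ j) := by
  have := Finset.card_filter_add_card_filter_not (s := H.occurrences j)
    (fun o => (H.lit o.1 o.2).2 = true)
  simp only [Bool.not_eq_true] at this
  rw [← hH j] at this
  exact ⟨_, this.symm⟩

end Formula

namespace Formula.AlternateOrder

variable (S : H.AlternateOrder)

theorem isPositive_iff (G : H.UnitGraph) : S.IsPositive G ↔ Even (G.2 : ℕ) :=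
  S.alternates G.1 G.2

theorem isPositive_next (hH : H.Balanced) (G : H.UnitGraph) :
    S.IsPositive (next G) ↔ ¬ S.IsPositive G := by
  rw [isPositive_iff, isPositive_iff, next_snd]
  split_ifs with hl
  · have h1 := hH.even_occ G.1
    rw [← show (G.2 : ℕ) + 1 = H.occ G.1 from hl, Nat.even_add_one] at h1
    simp [h1]
  · exact Nat.even_add_one

theorem not_isLast_of_isPositive (hH : H.Balanced) {G : H.UnitGraph} (hG : S.IsPositive G) :
    ¬ G.IsLast := by
  intro hl
  have h1 := hH.even_occ G.1
  rw [← show (G.2 : ℕ) + 1 = H.occ G.1 from hl, Nat.even_add_one] at h1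
  exact h1 ((S.isPositive_iff G).1 hG)

theorem isPositive_next_symm (hH : H.Balanced) (G : H.UnitGraph) :
    S.IsPositive (next.symm G) ↔ ¬ S.IsPositive G := by
  have := S.isPositive_next hH (next.symm G)
  rw [Equiv.apply_symm_apply] at this
  tauto

/-- A negative unit graph directly follows its cyclic predecessor in the global order, since the
first unit graph of a component is positive. -/
theorem h_next_symm (hH : H.Balanced) {G : H.UnitGraph} (hG : ¬ S.IsPositive G) :
    G.h = (next.symm G).h + 1 := by
  have h1 := h_next (next.symm G)
  rw [Equiv.apply_symm_apply,
    if_neg (S.not_isLast_of_isPositive hH ((S.isPositive_next_symm hH G).2 hG))] at h1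
  exact_mod_cast h1

/-! ### Unit graphs and places in clauses -/

/-- The place, within its clause, of the occurrence represented by `G`. -/
def place (G : H.UnitGraph) : Fin 3 := (S.seq G.1 G.2).1.2

theorem lit_fst (G : H.UnitGraph) : (H.lit (S.clause G) (S.place G)).1 = G.1 :=
  (Finset.mem_filter.1 (S.seq G.1 G.2).2).2

/-- The unit graphs correspond to the pairs of a clause and a place in it. -/
noncomputable def unitEquiv : H.UnitGraph ≃ Fin k × Fin 3 :=
  Equiv.ofBijective (fun G => (S.clause G, S.place G)) <| by
    constructor
    · rintro ⟨j, r⟩ ⟨j', r'⟩ h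
      have h1 := S.lit_fst ⟨j, r⟩
      have h2 := S.lit_fst ⟨j', r'⟩
      simp only [Prod.mk.injEq] at h
      rw [h.1, h.2, h2] at h1
      obtain rfl : j' = j := h1
      congr 1
      exact (S.seq j').injective (Subtype.ext (Prod.ext h.1 h.2))
    · rintro ⟨i, s⟩
      have hmem : (i, s) ∈ H.occurrences (H.lit i s).1 := by simp [occurrences]
      exact ⟨⟨(H.lit i s).1, (S.seq _).symm ⟨_, hmem⟩⟩, by simp [clause, place]⟩

theorem litValue_eq_true_iff (τ : Fin p → Bool) (G : H.UnitGraph) :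
    litValue τ (H.lit (S.clause G) (S.place G)) = true ↔ (S.IsPositive G ↔ τ G.1 = true) := by
  change _ ↔ ((H.lit (S.clause G) (S.place G)).2 = true ↔ _)
  rw [litValue, lit_fst]
  split_ifs with h <;> simp [h]

/-! ### Membership in the domains -/

theorem mem_domD' {i : Fin k} {x : ℤ} :
    x ∈ domD' i ↔ 72 * k + 2 * (i : ℤ) + 1 ≤ x ∧ x ≤ 72 * k + 2 * (i : ℤ) + 2 := by
  simp only [domD', m, t, Finset.mem_Icc]
  omega

theorem mem_domE' {i : Fin k} {x : ℤ} :
    x ∈ domE' i ↔ 74 * k + 2 * (i : ℤ) + 1 ≤ x ∧ x ≤ 74 * k + 2 * (i : ℤ) + 2 := by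
  simp only [domE', q, m, t, Finset.mem_Icc]
  omega

variable {S}

theorem mem_domA_pos {G : H.UnitGraph} (hG : S.IsPositive G) {x : ℤ} :
    x ∈ S.domA G ↔ (G.h * 24 + 3 ≤ x ∧ x ≤ G.h * 24 + 6) ∨
      x ∈ domD' (S.clause G) ∨ x ∈ domE' (S.clause G) := by
  simp [domA, X, hG, t]

theorem mem_domA_neg {G : H.UnitGraph} (hG : ¬ S.IsPositive G) {x : ℤ} :
    x ∈ S.domA G ↔ (G.h * 24 + 3 ≤ x ∧ x ≤ G.h * 24 + 6) ∨
      ((next G).h * 24 + 21 ≤ x ∧ x ≤ (next G).h * 24 + 22) := by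
  rw [h_next]
  by_cases hl : G.IsLast <;> simp [domA, X, hG, hl, t]

theorem mem_domB {G : H.UnitGraph} {x : ℤ} :
    x ∈ domB G ↔ G.h * 24 + 9 ≤ x ∧ x ≤ G.h * 24 + 12 := by
  simp [domB, t]

theorem mem_domC_pos {G : H.UnitGraph} (hG : S.IsPositive G) {x : ℤ} :
    x ∈ S.domC G ↔ G.h * 24 + 15 ≤ x ∧ x ≤ G.h * 24 + 18 := by
  simp [domC, T, hG, t]

theorem mem_domC_neg {G : H.UnitGraph} (hG : ¬ S.IsPositive G) {x : ℤ} :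
    x ∈ S.domC G ↔ (G.h * 24 + 15 ≤ x ∧ x ≤ G.h * 24 + 18) ∨
      x ∈ domD' (S.clause G) ∨ x ∈ domE' (S.clause G) := by
  simp [domC, T, hG, t]

theorem mem_domA'_pos {G : H.UnitGraph} (hG : S.IsPositive G) {x : ℤ} :
    x ∈ S.domA' G ↔ (G.h * 24 + 7 ≤ x ∧ x ≤ G.h * 24 + 10) ∨
      (G.h * 24 + 1 ≤ x ∧ x ≤ G.h * 24 + 2) := by
  simp [domA', Y, hG, t]

theorem mem_domA'_neg {G : H.UnitGraph} (hG : ¬ S.IsPositive G) {x : ℤ} :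
    x ∈ S.domA' G ↔ (G.h * 24 + 7 ≤ x ∧ x ≤ G.h * 24 + 10) ∨
      (G.h * 24 - 7 ≤ x ∧ x ≤ G.h * 24 - 4) := by
  simp [domA', Y, hG, t]

theorem mem_domB' {G : H.UnitGraph} {x : ℤ} :
    x ∈ domB' G ↔ (G.h * 24 + 5 ≤ x ∧ x ≤ G.h * 24 + 8) ∨
      (G.h * 24 + 13 ≤ x ∧ x ≤ G.h * 24 + 16) := by
  simp [domB', t]

theorem mem_domC'_pos {G : H.UnitGraph} (hG : S.IsPositive G) {x : ℤ} :
    x ∈ S.domC' G ↔ (G.h * 24 + 11 ≤ x ∧ x ≤ G.h * 24 + 14) ∨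
      (G.h * 24 + 21 ≤ x ∧ x ≤ G.h * 24 + 22) := by
  simp [domC', Z, hG, t]

theorem mem_domC'_neg {G : H.UnitGraph} (hG : ¬ S.IsPositive G) {x : ℤ} :
    x ∈ S.domC' G ↔ (G.h * 24 + 11 ≤ x ∧ x ≤ G.h * 24 + 14) ∨
      (G.h * 24 + 23 ≤ x ∧ x ≤ G.h * 24 + 24) := by
  simp [domC', Z, hG, t]

theorem mem_domD {i : Fin k} {x : ℤ} :
    x ∈ S.domD i ↔ ∃ G : H.UnitGraph, S.clause G = i ∧
      ((S.IsPositive G ∧ G.h * 24 + 1 ≤ x ∧ x ≤ G.h * 24 + 2) ∨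
        (¬ S.IsPositive G ∧ G.h * 24 + 23 ≤ x ∧ x ≤ G.h * 24 + 24)) := by
  simp only [domD, Finset.mem_union, Finset.mem_biUnion, Finset.mem_filter, Finset.mem_univ,
    true_and, ← exists_or]
  refine exists_congr fun G => ?_
  by_cases hG : S.IsPositive G <;> simp [hG, Y, Z, t]

theorem mem_domE {i : Fin k} {x : ℤ} :
    x ∈ S.domE i ↔ x ∈ S.domD i ∨ ∃ s, s ≠ i ∧ x ∈ domE' s := by
  simp [domE]

variable (S)

/-! ### Sort-matchings in terms of vertices -/

theorem hasSortMatching_iff : HasSortMatching S.domU S.domV ↔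
    ∃ f : H.Vertex → H.Vertex, Function.Bijective f ∧
      (∀ v, ∃ x, x ∈ S.vertexDomU (f v) ∧ x ∈ S.vertexDomV v) ∧
      ∀ v w, (H.index v : ℕ) + 1 = H.index w →
        ∃ x y, (x ∈ S.vertexDomU (f v) ∧ x ∈ S.vertexDomV v) ∧
          (y ∈ S.vertexDomU (f w) ∧ y ∈ S.vertexDomV w) ∧ x ≤ y := by
  constructor
  · rintro ⟨σ, ⟨hinj, -, hsurj⟩, hQ, hlex⟩
    refine ⟨fun v => H.index.symm (σ (H.index v)), ⟨?_, ?_⟩, ?_, ?_⟩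
    · exact H.index.symm.injective.comp (hinj.comp H.index.injective)
    · exact H.index.symm.surjective.comp (hsurj.comp H.index.surjective)
    · intro v
      obtain ⟨x, hx⟩ := hQ (H.index v)
      simp only [Q, domU, domV, Finset.mem_inter, Equiv.symm_apply_apply] at hx
      exact ⟨x, hx⟩
    · intro v w hvw
      obtain ⟨x, hx, y, hy, hxy⟩ := hlex _ _ hvw
      simp only [Q, domU, domV, Finset.mem_inter, Equiv.symm_apply_apply] at hx hy
      exact ⟨x, y, hx, hy, hxy⟩
  · rintro ⟨f, hf, hQ, hlex⟩
    have hQ' : ∀ n, (Q S.domU S.domV (fun n => H.index (f (H.index.symm n))) n).Nonempty := by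
      intro n
      obtain ⟨x, hx⟩ := hQ (H.index.symm n)
      exact ⟨x, by simpa [Q, domU, domV] using hx⟩
    refine ⟨fun n => H.index (f (H.index.symm n)), ⟨?_, ?_, ?_⟩, hQ', ?_⟩
    · exact H.index.injective.comp (hf.1.comp H.index.symm.injective)
    · intro n
      rw [intersectionGraph, SimpleGraph.fromRel_adj]
      exact ⟨by simp, Or.inl ⟨_, _, rfl, rfl, hQ' n⟩⟩
    · exact H.index.surjective.comp (hf.2.comp H.index.symm.surjective)
    · intro n n' hn
      obtain ⟨x, y, hx, hy, hxy⟩ := hlex (H.index.symm n) (H.index.symm n') (by simpa using hn)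
      exact ⟨x, by simpa [Q, domU, domV] using hx, y, by simpa [Q, domU, domV] using hy, hxy⟩

end Formula.AlternateOrder

namespace Formula.AlternateOrder

variable {S : H.AlternateOrder}

/-! ### The edges of the intersection graph -/

theorem cases_of_mem_vertexDomU {u : H.Vertex} {x : ℤ} (hu : x ∈ S.vertexDomU u) :
    (∃ G, u = Sum.inl (G, 0) ∧ G.h * 24 + 3 ≤ x ∧ x ≤ G.h * 24 + 6) ∨
    (∃ G, S.IsPositive G ∧ u = Sum.inl (G, 0) ∧
      (x ∈ domD' (S.clause G) ∨ x ∈ domE' (S.clause G))) ∨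
    (∃ G, ¬ S.IsPositive G ∧ u = Sum.inl (G, 0) ∧
      (next G).h * 24 + 21 ≤ x ∧ x ≤ (next G).h * 24 + 22) ∨
    (∃ G, u = Sum.inl (G, 1) ∧ G.h * 24 + 9 ≤ x ∧ x ≤ G.h * 24 + 12) ∨
    (∃ G, u = Sum.inl (G, 2) ∧ G.h * 24 + 15 ≤ x ∧ x ≤ G.h * 24 + 18) ∨
    (∃ G, ¬ S.IsPositive G ∧ u = Sum.inl (G, 2) ∧
      (x ∈ domD' (S.clause G) ∨ x ∈ domE' (S.clause G))) ∨
    (∃ G, (u = Sum.inr (Sum.inl (S.clause G)) ∨ u = Sum.inr (Sum.inr (S.clause G))) ∧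
      ((S.IsPositive G ∧ G.h * 24 + 1 ≤ x ∧ x ≤ G.h * 24 + 2) ∨
        (¬ S.IsPositive G ∧ G.h * 24 + 23 ≤ x ∧ x ≤ G.h * 24 + 24))) ∨
    ∃ i s, s ≠ i ∧ u = Sum.inr (Sum.inr i) ∧ x ∈ domE' s := by
  rcases u with ⟨G, c⟩ | i | i
  · obtain rfl | rfl | rfl : c = 0 ∨ c = 1 ∨ c = 2 := by fin_cases c <;> simp
    · change x ∈ S.domA G at hu
      by_cases hG : S.IsPositive G
      · rw [mem_domA_pos hG] at hu
        rcases hu with hu | hu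
        · exact Or.inl ⟨G, rfl, hu⟩
        · exact Or.inr (Or.inl ⟨G, hG, rfl, hu⟩)
      · rw [mem_domA_neg hG] at hu
        rcases hu with hu | hu
        · exact Or.inl ⟨G, rfl, hu⟩
        · exact Or.inr (Or.inr (Or.inl ⟨G, hG, rfl, hu⟩))
    · exact Or.inr (Or.inr (Or.inr (Or.inl ⟨G, rfl, mem_domB.1 hu⟩)))
    · change x ∈ S.domC G at hu
      by_cases hG : S.IsPositive G
      · exact Or.inr (Or.inr (Or.inr (Or.inr (Or.inl ⟨G, rfl, (mem_domC_pos hG).1 hu⟩))))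
      · rw [mem_domC_neg hG] at hu
        rcases hu with hu | hu
        · exact Or.inr (Or.inr (Or.inr (Or.inr (Or.inl ⟨G, rfl, hu⟩))))
        · exact Or.inr (Or.inr (Or.inr (Or.inr (Or.inr (Or.inl ⟨G, hG, rfl, hu⟩)))))
  · obtain ⟨G, rfl, hG⟩ := mem_domD.1 hu
    exact Or.inr (Or.inr (Or.inr (Or.inr (Or.inr (Or.inr (Or.inl ⟨G, Or.inl rfl, hG⟩))))))
  · rcases mem_domE.1 hu with hu | ⟨s, hs, hu⟩
    · obtain ⟨G, rfl, hG⟩ := mem_domD.1 hu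
      exact Or.inr (Or.inr (Or.inr (Or.inr (Or.inr (Or.inr (Or.inl ⟨G, Or.inr rfl, hG⟩))))))
    · exact Or.inr (Or.inr (Or.inr (Or.inr (Or.inr (Or.inr (Or.inr ⟨i, s, hs, rfl, hu⟩))))))

theorem cases_of_mem_vertexDomV (hH : H.Balanced) {v : H.Vertex} {x : ℤ}
    (hv : x ∈ S.vertexDomV v) :
    (∃ G, v = Sum.inl (G, 0) ∧ G.h * 24 + 7 ≤ x ∧ x ≤ G.h * 24 + 10) ∨
    (∃ G, S.IsPositive G ∧ v = Sum.inl (G, 0) ∧ G.h * 24 + 1 ≤ x ∧ x ≤ G.h * 24 + 2) ∨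
    (∃ G, ¬ S.IsPositive G ∧ v = Sum.inl (G, 0) ∧
      (next.symm G).h * 24 + 17 ≤ x ∧ x ≤ (next.symm G).h * 24 + 20) ∨
    (∃ G, v = Sum.inl (G, 1) ∧ G.h * 24 + 5 ≤ x ∧ x ≤ G.h * 24 + 8) ∨
    (∃ G, v = Sum.inl (G, 1) ∧ G.h * 24 + 13 ≤ x ∧ x ≤ G.h * 24 + 16) ∨
    (∃ G, v = Sum.inl (G, 2) ∧ G.h * 24 + 11 ≤ x ∧ x ≤ G.h * 24 + 14) ∨
    (∃ G, S.IsPositive G ∧ v = Sum.inl (G, 2) ∧ G.h * 24 + 21 ≤ x ∧ x ≤ G.h * 24 + 22) ∨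
    (∃ G, ¬ S.IsPositive G ∧ v = Sum.inl (G, 2) ∧ G.h * 24 + 23 ≤ x ∧ x ≤ G.h * 24 + 24) ∨
    (∃ i, v = Sum.inr (Sum.inl i) ∧ x ∈ domD' i) ∨
    ∃ i, v = Sum.inr (Sum.inr i) ∧ x ∈ domE' i := by
  rcases v with ⟨G, c⟩ | i | i
  · obtain rfl | rfl | rfl : c = 0 ∨ c = 1 ∨ c = 2 := by fin_cases c <;> simp
    · change x ∈ S.domA' G at hv
      by_cases hG : S.IsPositive G
      · rw [mem_domA'_pos hG] at hv
        rcases hv with hv | hv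
        · exact Or.inl ⟨G, rfl, hv⟩
        · exact Or.inr (Or.inl ⟨G, hG, rfl, hv⟩)
      · rw [mem_domA'_neg hG] at hv
        rcases hv with hv | hv
        · exact Or.inl ⟨G, rfl, hv⟩
        · have := S.h_next_symm hH hG
          exact Or.inr (Or.inr (Or.inl ⟨G, hG, rfl, by omega⟩))
    · rcases mem_domB'.1 hv with hv | hv
      · exact Or.inr (Or.inr (Or.inr (Or.inl ⟨G, rfl, hv⟩)))
      · exact Or.inr (Or.inr (Or.inr (Or.inr (Or.inl ⟨G, rfl, hv⟩))))
    · change x ∈ S.domC' G at hv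
      by_cases hG : S.IsPositive G
      · rw [mem_domC'_pos hG] at hv
        rcases hv with hv | hv
        · exact Or.inr (Or.inr (Or.inr (Or.inr (Or.inr (Or.inl ⟨G, rfl, hv⟩)))))
        · exact Or.inr (Or.inr (Or.inr (Or.inr (Or.inr (Or.inr (Or.inl ⟨G, hG, rfl, hv⟩))))))
      · rw [mem_domC'_neg hG] at hv
        rcases hv with hv | hv
        · exact Or.inr (Or.inr (Or.inr (Or.inr (Or.inr (Or.inl ⟨G, rfl, hv⟩)))))
        · exact Or.inr (Or.inr (Or.inr (Or.inr (Or.inr (Or.inr (Or.inr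
            (Or.inl ⟨G, hG, rfl, hv⟩)))))))
  · exact Or.inr (Or.inr (Or.inr (Or.inr (Or.inr (Or.inr (Or.inr (Or.inr
      (Or.inl ⟨i, rfl, hv⟩))))))))
  · exact Or.inr (Or.inr (Or.inr (Or.inr (Or.inr (Or.inr (Or.inr (Or.inr
      (Or.inr ⟨i, rfl, hv⟩))))))))

/-- The edges of the intersection graph: apart from the paths `a' - b - c'` and `a - b' - c` inside
each unit graph, the links between cyclically consecutive unit graphs and the links between unit
graphs and their clauses, there are only the edges `e_i - e'_s`. For the edges inside a unit graph
the position of the common values is recorded. -/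
theorem edge_cases (hH : H.Balanced) {u v : H.Vertex} {x : ℤ}
    (hu : x ∈ S.vertexDomU u) (hv : x ∈ S.vertexDomV v) :
    (∃ G, u = Sum.inl (G, 1) ∧ v = Sum.inl (G, 0) ∧ G.h * 24 + 9 ≤ x ∧ x ≤ G.h * 24 + 10) ∨
    (∃ G, u = Sum.inl (G, 1) ∧ v = Sum.inl (G, 2) ∧ G.h * 24 + 11 ≤ x ∧ x ≤ G.h * 24 + 12) ∨
    (∃ G, u = Sum.inl (G, 0) ∧ v = Sum.inl (G, 1) ∧ G.h * 24 + 5 ≤ x ∧ x ≤ G.h * 24 + 6) ∨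
    (∃ G, u = Sum.inl (G, 2) ∧ v = Sum.inl (G, 1) ∧ G.h * 24 + 15 ≤ x ∧ x ≤ G.h * 24 + 16) ∨
    (∃ G, S.IsPositive G ∧ u = Sum.inl (G, 2) ∧ v = Sum.inl (next G, 0)) ∨
    (∃ G, ¬ S.IsPositive G ∧ u = Sum.inl (G, 0) ∧ v = Sum.inl (next G, 2)) ∨
    (∃ G, (u = Sum.inr (Sum.inl (S.clause G)) ∨ u = Sum.inr (Sum.inr (S.clause G))) ∧
      ((S.IsPositive G ∧ v = Sum.inl (G, 0)) ∨ (¬ S.IsPositive G ∧ v = Sum.inl (G, 2)))) ∨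
    (∃ G, (v = Sum.inr (Sum.inl (S.clause G)) ∨ v = Sum.inr (Sum.inr (S.clause G))) ∧
      ((S.IsPositive G ∧ u = Sum.inl (G, 0)) ∨ (¬ S.IsPositive G ∧ u = Sum.inl (G, 2)))) ∨
    ∃ i s, s ≠ i ∧ u = Sum.inr (Sum.inr i) ∧ v = Sum.inr (Sum.inr s) := by
  have key : ∀ {G G' : H.UnitGraph}, G.h = G'.h → G = G' := fun h => UnitGraph.h_injective h
  rcases cases_of_mem_vertexDomU hu with ⟨G, rfl, h1⟩ | ⟨G, hG, rfl, h1⟩ | ⟨G, hG, rfl, h1⟩ |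
    ⟨G, rfl, h1⟩ | ⟨G, rfl, h1⟩ | ⟨G, hG, rfl, h1⟩ | ⟨G, hu', h1⟩ | ⟨i, s, hs, rfl, h1⟩ <;>
  rcases cases_of_mem_vertexDomV hH hv with ⟨G', rfl, h2⟩ | ⟨G', hG', rfl, h2⟩ |
    ⟨G', hG', rfl, h2⟩ | ⟨G', rfl, h2⟩ | ⟨G', rfl, h2⟩ | ⟨G', rfl, h2⟩ | ⟨G', hG', rfl, h2⟩ |
    ⟨G', hG', rfl, h2⟩ | ⟨i', rfl, h2⟩ | ⟨i', rfl, h2⟩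
  -- All other pairs of ranges are disjoint, because they lie in different places modulo `24` or
  -- because the unit graphs stay below `72 k + 1`.
  all_goals try simp only [mem_domD', mem_domE'] at h1
  all_goals try simp only [mem_domD', mem_domE'] at h2
  all_goals try have b1 := G.h_lt
  all_goals try have b2 := G'.h_lt
  all_goals try have b3 := (next G).h_lt
  all_goals try have b4 := (next.symm G').h_lt
  all_goals try have b5 := (S.clause G).isLt
  all_goals try have b6 := i'.isLt
  all_goals try have b7 := s.isLt
  all_goals try (exfalso; omega)
  -- The pairs of ranges with a common value.
  · obtain rfl : G = G' := key (by omega)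
    exact Or.inr (Or.inr (Or.inl ⟨G, rfl, rfl, by omega⟩))
  · obtain rfl : i' = S.clause G := Fin.ext (by omega)
    exact Or.inr (Or.inr (Or.inr (Or.inr
      (Or.inr (Or.inr (Or.inr (Or.inl ⟨G, Or.inl rfl, Or.inl ⟨hG, rfl⟩⟩)))))))
  · obtain rfl : i' = S.clause G := Fin.ext (by omega)
    exact Or.inr (Or.inr (Or.inr (Or.inr
      (Or.inr (Or.inr (Or.inr (Or.inl ⟨G, Or.inr rfl, Or.inl ⟨hG, rfl⟩⟩)))))))
  · obtain rfl : next G = G' := key (by omega)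
    exact Or.inr (Or.inr (Or.inr (Or.inr (Or.inr (Or.inl ⟨G, hG, rfl, rfl⟩)))))
  · obtain rfl : G = G' := key (by omega)
    exact Or.inl ⟨G, rfl, rfl, by omega⟩
  · obtain rfl : G = G' := key (by omega)
    exact Or.inr (Or.inl ⟨G, rfl, rfl, by omega⟩)
  · obtain rfl : G = next.symm G' := key (by omega)
    exact Or.inr (Or.inr (Or.inr (Or.inr (Or.inl
      ⟨_, (S.isPositive_next_symm hH G').2 hG', rfl, by simp⟩))))
  · obtain rfl : G = G' := key (by omega)
    exact Or.inr (Or.inr (Or.inr (Or.inl ⟨G, rfl, rfl, by omega⟩)))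
  · obtain rfl : i' = S.clause G := Fin.ext (by omega)
    exact Or.inr (Or.inr (Or.inr (Or.inr
      (Or.inr (Or.inr (Or.inr (Or.inl ⟨G, Or.inl rfl, Or.inr ⟨hG, rfl⟩⟩)))))))
  · obtain rfl : i' = S.clause G := Fin.ext (by omega)
    exact Or.inr (Or.inr (Or.inr (Or.inr
      (Or.inr (Or.inr (Or.inr (Or.inl ⟨G, Or.inr rfl, Or.inr ⟨hG, rfl⟩⟩)))))))
  · obtain rfl : G = G' := key (by omega)
    exact Or.inr (Or.inr (Or.inr (Or.inr (Or.inr (Or.inr (Or.inl ⟨G, hu', Or.inl ⟨hG', rfl⟩⟩))))))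
  · obtain rfl : G = G' := key (by omega)
    exact Or.inr (Or.inr (Or.inr (Or.inr (Or.inr (Or.inr (Or.inl ⟨G, hu', Or.inr ⟨hG', rfl⟩⟩))))))
  · obtain rfl : i' = s := Fin.ext (by omega)
    exact Or.inr (Or.inr (Or.inr (Or.inr
      (Or.inr (Or.inr (Or.inr (Or.inr ⟨i, i', hs, rfl, rfl⟩)))))))

/-! ### From sort-matchings to truth assignments -/

/-- A property invariant under a single cyclic step is constant on each consistency component. -/
theorem iff_of_next {P : H.UnitGraph → Prop} (hP : ∀ G, P (next G) ↔ P G) {G G' : H.UnitGraph}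
    (hG : G.1 = G'.1) : P G ↔ P G' := by
  have key : ∀ (j : Fin p) (n : ℕ) (hn : n < H.occ j),
      P ⟨j, ⟨n, hn⟩⟩ ↔ P ⟨j, ⟨0, by omega⟩⟩ := by
    intro j n
    induction n with
    | zero => exact fun _ => Iff.rfl
    | succ n ih =>
      intro hn
      rw [← ih (by omega), ← hP ⟨j, ⟨n, by omega⟩⟩]
      have : next (⟨j, ⟨n, by omega⟩⟩ : H.UnitGraph) = ⟨j, ⟨n + 1, hn⟩⟩ := by
        refine Sigma.ext rfl (heq_of_eq (Fin.ext ?_))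
        rw [next_snd, if_neg]
        exact hn.ne
      rw [this]
  obtain ⟨j, r⟩ := G
  obtain ⟨j', r'⟩ := G'
  obtain rfl : j = j' := hG
  exact (key j r r.2).trans (key j r' r'.2).symm

theorem naeSatisfiable_of_hasSortMatching (hH : H.Balanced)
    (hS : HasSortMatching S.domU S.domV) : H.NAESatisfiable := by
  obtain ⟨f, hf, hne, hlex⟩ := S.hasSortMatching_iff.1 hS
  -- `P G` says that `b'` is matched with `c`; the alternative is `a`.
  set P : H.UnitGraph → Prop := fun G => f (Sum.inl (G, 1)) = Sum.inl (G, 2)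
  have hb' : ∀ G, ¬ P G → f (Sum.inl (G, 1)) = Sum.inl (G, 0) := by
    intro G hG
    obtain ⟨x, hu, hv⟩ := hne (Sum.inl (G, 1))
    have := edge_cases hH hu hv
    -- `Sigma.exists` would split the unit graphs into their components.
    simp [-Sigma.exists] at this
    rcases this with h | h
    · exact h.1
    · exact absurd h.1 hG
  have hlex1 : ∀ G, f (Sum.inl (G, 0)) = Sum.inl (G, 1) → P G := by
    intro G hG
    by_contra hPG
    obtain ⟨x, y, ⟨hu, hv⟩, ⟨hu', hv'⟩, hxy⟩ :=
      hlex (Sum.inl (G, 0)) (Sum.inl (G, 1)) (by rw [coe_index_unit, coe_index_unit]; simp; omega)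
    rw [hG] at hu
    rw [hb' G hPG] at hu'
    have h1 := edge_cases hH hu hv
    have h2 := edge_cases hH hu' hv'
    simp [-Sigma.exists] at h1 h2
    omega
  have hlex2 : ∀ G, f (Sum.inl (G, 2)) = Sum.inl (G, 1) → ¬ P G := by
    intro G hG hPG
    obtain ⟨x, y, ⟨hu, hv⟩, ⟨hu', hv'⟩, hxy⟩ :=
      hlex (Sum.inl (G, 1)) (Sum.inl (G, 2)) (by rw [coe_index_unit, coe_index_unit]; simp; omega)
    rw [hG] at hu'
    rw [show f (Sum.inl (G, 1)) = Sum.inl (G, 2) from hPG] at hu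
    have h1 := edge_cases hH hu hv
    have h2 := edge_cases hH hu' hv'
    simp [-Sigma.exists] at h1 h2
    omega
  have hb : ∀ G, f (Sum.inl (G, 0)) = Sum.inl (G, 1) ∨ f (Sum.inl (G, 2)) = Sum.inl (G, 1) := by
    intro G
    obtain ⟨v, hfv⟩ := hf.2 (Sum.inl (G, 1))
    obtain ⟨x, hu, hv⟩ := hne v
    have := edge_cases hH hu hv
    rw [hfv] at this
    simp [-Sigma.exists] at this
    rcases this with h | h
    · exact Or.inl (h.1 ▸ hfv)
    · exact Or.inr (h.1 ▸ hfv)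
  have ha'_iff : ∀ G, f (Sum.inl (G, 0)) = Sum.inl (G, 1) ↔ P G := fun G =>
    ⟨hlex1 G, fun hG => (hb G).resolve_right fun h => hlex2 G h hG⟩
  have hc'_iff : ∀ G, f (Sum.inl (G, 2)) = Sum.inl (G, 1) ↔ ¬ P G := fun G =>
    ⟨hlex2 G, fun hG => (hb G).resolve_left fun h => hG (hlex1 G h)⟩
  have hnext : ∀ G, P (next G) ↔ P G := by
    intro G
    by_cases hG : S.IsPositive G
    · have hG' : ¬ S.IsPositive (next G) := fun h => (S.isPositive_next hH G).1 h hG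
      -- The edge `c - a'` between the two unit graphs is used iff `P` fails at either of them.
      have h1 : f (Sum.inl (next G, 0)) = Sum.inl (G, 2) ↔ ¬ P (next G) := by
        rw [← ha'_iff]
        obtain ⟨x, hu, hv⟩ := hne (Sum.inl (next G, 0))
        have := edge_cases hH hu hv
        simp [-Sigma.exists, hG'] at this
        rcases this with h | h
        · simp [h.1]
        · simp [h.2]
      have h2 : f (Sum.inl (next G, 0)) = Sum.inl (G, 2) ↔ ¬ P G := by
        constructor
        · intro h hPG
          have := hf.1 (h.trans hPG.symm)
          simp at this
        · intro hPG
          obtain ⟨v, hfv⟩ := hf.2 (Sum.inl (G, 2))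
          obtain ⟨x, hu, hv⟩ := hne v
          have := edge_cases hH hu hv
          rw [hfv] at this
          simp [-Sigma.exists, hG] at this
          rcases this with h | h
          · rw [h.1, hb' G hPG] at hfv
            simp at hfv
          · rw [← h, hfv]
      rw [← not_iff_not, ← h1, h2]
    · have hG' : S.IsPositive (next G) := (S.isPositive_next hH G).2 hG
      -- The edge `a - c'` between the two unit graphs is used iff `P` holds at either of them.
      have h1 : f (Sum.inl (next G, 2)) = Sum.inl (G, 0) ↔ P (next G) := by
        rw [← not_iff_not, ← hc'_iff]
        obtain ⟨x, hu, hv⟩ := hne (Sum.inl (next G, 2))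
        have := edge_cases hH hu hv
        simp [-Sigma.exists, hG'] at this
        rcases this with h | h
        · simp [h.1]
        · simp [h.2]
      have h2 : f (Sum.inl (next G, 2)) = Sum.inl (G, 0) ↔ P G := by
        constructor
        · intro h
          by_contra hPG
          have := hf.1 (h.trans (hb' G hPG).symm)
          simp at this
        · intro hPG
          obtain ⟨v, hfv⟩ := hf.2 (Sum.inl (G, 0))
          obtain ⟨x, hu, hv⟩ := hne v
          have := edge_cases hH hu hv
          rw [hfv] at this
          simp [-Sigma.exists, hG] at this
          rcases this with h | h
          · rw [h.1, show f (Sum.inl (G, 1)) = Sum.inl (G, 2) from hPG] at hfv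
            simp at hfv
          · rw [← h, hfv]
      rw [← h1, h2]
  -- `x_j` is true iff `P` holds on `CC_j`.
  set τ : Fin p → Bool := fun j => decide (∃ G : H.UnitGraph, G.1 = j ∧ P G) with hτ
  have hval : ∀ G : H.UnitGraph,
      litValue τ (H.lit (S.clause G) (S.place G)) = true ↔ (S.IsPositive G ↔ P G) := by
    intro G
    rw [litValue_eq_true_iff]
    have hτG : τ G.1 = true ↔ P G := by
      simp only [hτ, decide_eq_true_iff]
      exact ⟨fun ⟨G', h, hP'⟩ => (iff_of_next hnext h).1 hP', fun h => ⟨G, rfl, h⟩⟩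
    rw [hτG]
  refine ⟨τ, fun i => ⟨?_, ?_⟩⟩
  · obtain ⟨x, hu, hv⟩ := hne (Sum.inr (Sum.inl i))
    have := edge_cases hH hu hv
    simp [-Sigma.exists] at this
    obtain ⟨G, rfl, ⟨hG, h⟩ | ⟨hG, h⟩⟩ := this
    · refine ⟨_, (hval G).2 (iff_of_true hG ?_)⟩
      by_contra hPG
      have := hf.1 (h.trans (hb' G hPG).symm)
      simp at this
    · refine ⟨_, (hval G).2 (iff_of_false hG fun hPG => ?_)⟩
      have := hf.1 (h.trans hPG.symm)
      simp at this
  · obtain ⟨v, hfv⟩ := hf.2 (Sum.inr (Sum.inl i))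
    obtain ⟨x, hu, hv⟩ := hne v
    have := edge_cases hH hu hv
    rw [hfv] at this
    simp [-Sigma.exists] at this
    obtain ⟨G, rfl, ⟨hG, rfl⟩ | ⟨hG, rfl⟩⟩ := this
    · refine ⟨S.place G, Bool.eq_false_iff.2 fun h => ?_⟩
      have hPG := ((hval G).1 h).1 hG
      rw [← ha'_iff, hfv] at hPG
      simp at hPG
    · refine ⟨S.place G, Bool.eq_false_iff.2 fun h => ?_⟩
      have hPG := (not_congr ((hval G).1 h)).1 hG
      rw [← hc'_iff, hfv] at hPG
      simp at hPG

end Formula.AlternateOrder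

/-! ### Counting true and false literals -/

namespace Formula

/-- Under any assignment a balanced formula has as many true as false literals: among the occurrences
of `x_j` the true ones are either all the positive or all the negative ones. -/
theorem sum_sign_litValue (hH : H.Balanced) (τ : Fin p → Bool) :
    ∑ o : Fin k × Fin 3, (if litValue τ (H.lit o.1 o.2) = true then (1 : ℤ) else -1) = 0 := by
  rw [← Finset.sum_fiberwise (g := fun o : Fin k × Fin 3 => (H.lit o.1 o.2).1)]
  refine Finset.sum_eq_zero fun j _ => ?_
  change ∑ o ∈ H.occurrences j, _ = _
  have h1 : ∑ o ∈ H.occurrences j, (if (H.lit o.1 o.2).2 = true then (1 : ℤ) else -1) = 0 := by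
    have h := hH j
    simp only [← Bool.not_eq_true] at h
    rw [Finset.sum_ite, Finset.sum_const, Finset.sum_const, h]
    simp
  have h2 : ∀ o ∈ H.occurrences j, (if litValue τ (H.lit o.1 o.2) = true then (1 : ℤ) else -1) =
      (if τ j = true then 1 else -1) * (if (H.lit o.1 o.2).2 = true then (1 : ℤ) else -1) := by
    intro o ho
    rw [litValue, (Finset.mem_filter.1 ho).2]
    cases τ j <;> cases (H.lit o.1 o.2).2 <;> simp
  rw [Finset.sum_congr rfl h2, ← Finset.mul_sum, h1, mul_zero]

/-- In each clause let `y i` be the place of a true literal, `z i` that of a false one, and `w i`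
the remaining place. As there are as many true literals as false ones in a balanced formula, there
are as many true literals as false ones at the places `w i`, so `π` can pair the clauses with a
false literal at `w` with the clauses with a true literal at `w`. -/
theorem exists_pairing (hH : H.Balanced) (τ : Fin p → Bool) {y z w : Fin k → Fin 3}
    (hyz : ∀ i, y i ≠ z i) (hwy : ∀ i, w i ≠ y i) (hwz : ∀ i, w i ≠ z i)
    (hy : ∀ i, litValue τ (H.lit i (y i)) = true) (hz : ∀ i, litValue τ (H.lit i (z i)) = false) :
    ∃ π : Fin k → Fin k,
      (∀ i, litValue τ (H.lit i (w i)) = false → litValue τ (H.lit (π i) (w (π i))) = true) ∧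
      ∀ i', litValue τ (H.lit i' (w i')) = true →
        ∃ i, litValue τ (H.lit i (w i)) = false ∧ π i = i' := by
  have hsum := sum_sign_litValue hH τ
  rw [Fintype.sum_prod_type] at hsum
  have huniv : ∀ a b c : Fin 3, a ≠ b → c ≠ a → c ≠ b →
      (Finset.univ : Finset (Fin 3)) = {a, b, c} := by
    decide
  have hrow : ∀ i, ∑ s, (if litValue τ (H.lit i s) = true then (1 : ℤ) else -1) =
      if litValue τ (H.lit i (w i)) = true then (1 : ℤ) else -1 := by
    intro i
    rw [huniv _ _ _ (hyz i) (hwy i) (hwz i), Finset.sum_insert, Finset.sum_insert,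
      Finset.sum_singleton]
    · simp [hy i, hz i]
    · simpa using (hwz i).symm
    · simpa using ⟨hyz i, (hwy i).symm⟩
  simp only [hrow] at hsum
  rw [Finset.sum_ite, Finset.sum_const, Finset.sum_const] at hsum
  simp only [mul_one, nsmul_eq_mul, mul_neg] at hsum
  have hcard : (Finset.univ.filter fun i => ¬ litValue τ (H.lit i (w i)) = true).card =
      (Finset.univ.filter fun i => litValue τ (H.lit i (w i)) = true).card := by
    omega
  let e := Finset.equivOfCardEq hcard
  refine ⟨fun i => if h : i ∈ Finset.univ.filter fun i => ¬ litValue τ (H.lit i (w i)) = true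
    then e ⟨i, h⟩ else i, ?_, ?_⟩
  · intro i hi
    have h : i ∈ Finset.univ.filter fun i => ¬ litValue τ (H.lit i (w i)) = true := by simp [hi]
    simp only [dif_pos h]
    exact (Finset.mem_filter.1 (e ⟨i, h⟩).2).2
  · intro i' hi'
    let i := e.symm ⟨i', by simp [hi']⟩
    refine ⟨i, by simpa using (Finset.mem_filter.1 i.2).2, ?_⟩
    simp only [dif_pos i.2]
    simp [i]

end Formula

/-! ### From truth assignments to sort-matchings -/

namespace Formula.AlternateOrder

variable (S : H.AlternateOrder) (τ : Fin p → Bool) (y z w : Fin k → Fin 3) (π : Fin k → Fin k)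

/-- The vertex among `a`, `c` that links `G` to `d'_i` and `e'_i`, where `G` belongs to clause
`i`. -/
noncomputable def clauseU (G : H.UnitGraph) : H.Vertex :=
  if S.IsPositive G then Sum.inl (G, 0) else Sum.inl (G, 2)

/-- The partner for the vertex among `a'`, `c'` that links `G` to `d_i` and `e_i`: it is `d_i` for
the occurrence at place `z i` of clause `i`, and `e_i` for the others. -/
noncomputable def clauseTarget (G : H.UnitGraph) : H.Vertex :=
  if S.place G = z (S.clause G) then Sum.inr (Sum.inl (S.clause G))
  else Sum.inr (Sum.inr (S.clause G))

/-- The matching of an assignment `τ`, given the places `y i` of a true literal, `z i` of a false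
one, and `w i` of the remaining literal in each clause, and a pairing `π` of the clauses with a
false literal at `w` with those with a true one. -/
noncomputable def matching : H.Vertex → H.Vertex
  | Sum.inl (G, 0) =>
    if τ G.1 = true then Sum.inl (G, 1)
    else if S.IsPositive G then S.clauseTarget z G else Sum.inl (next.symm G, 2)
  | Sum.inl (G, 1) => if τ G.1 = true then Sum.inl (G, 2) else Sum.inl (G, 0)
  | Sum.inl (G, 2) =>
    if τ G.1 = true then
      if S.IsPositive G then Sum.inl (next.symm G, 0) else S.clauseTarget z G
    else Sum.inl (G, 1)
  | Sum.inr (Sum.inl i) => S.clauseU (S.unitEquiv.symm (i, y i))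
  | Sum.inr (Sum.inr i) =>
    if litValue τ (H.lit i (w i)) = true then S.clauseU (S.unitEquiv.symm (i, w i))
    else Sum.inr (Sum.inr (π i))

/-- A common value of `Dom(v)` and of the domain of the partner of `v` in `matching`; these values
increase along the global order. -/
def matchingValue : H.Vertex → ℤ
  | Sum.inl (G, 0) => G.h * 24 + if τ G.1 = true then 9 else if S.IsPositive G then 1 else -7
  | Sum.inl (G, 1) => G.h * 24 + if τ G.1 = true then 15 else 5
  | Sum.inl (G, 2) => G.h * 24 + if τ G.1 = true then if S.IsPositive G then 21 else 23 else 11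
  | Sum.inr (Sum.inl i) => 72 * k + 2 * (i : ℤ) + 1
  | Sum.inr (Sum.inr i) => 74 * k + 2 * (i : ℤ) + 1

variable {S τ y z w π}

@[simp] theorem clause_unitEquiv_symm (o : Fin k × Fin 3) :
    S.clause (S.unitEquiv.symm o) = o.1 :=
  congrArg Prod.fst (S.unitEquiv.apply_symm_apply o)

@[simp] theorem place_unitEquiv_symm (o : Fin k × Fin 3) :
    S.place (S.unitEquiv.symm o) = o.2 :=
  congrArg Prod.snd (S.unitEquiv.apply_symm_apply o)

theorem unitEquiv_symm_clause_place (G : H.UnitGraph) :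
    S.unitEquiv.symm (S.clause G, S.place G) = G :=
  S.unitEquiv.symm_apply_apply G

theorem matchingValue_mem_vertexDomV (v : H.Vertex) :
    S.matchingValue τ v ∈ S.vertexDomV v := by
  rcases v with ⟨G, c⟩ | i | i
  · obtain rfl | rfl | rfl : c = 0 ∨ c = 1 ∨ c = 2 := by fin_cases c <;> simp
    · change _ ∈ S.domA' G
      by_cases hG : S.IsPositive G
      · rw [mem_domA'_pos hG, matchingValue]
        split_ifs <;> omega
      · rw [mem_domA'_neg hG, matchingValue]
        split_ifs <;> omega
    · change _ ∈ domB' G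
      rw [mem_domB', matchingValue]
      split_ifs <;> omega
    · change _ ∈ S.domC' G
      by_cases hG : S.IsPositive G
      · rw [mem_domC'_pos hG, matchingValue]
        split_ifs <;> omega
      · rw [mem_domC'_neg hG, matchingValue]
        split_ifs <;> omega
  · change _ ∈ domD' i
    rw [mem_domD', matchingValue]
    omega
  · change _ ∈ domE' i
    rw [mem_domE', matchingValue]
    omega

theorem mem_clauseTarget {G : H.UnitGraph} {x : ℤ}
    (h : (S.IsPositive G ∧ G.h * 24 + 1 ≤ x ∧ x ≤ G.h * 24 + 2) ∨
        (¬ S.IsPositive G ∧ G.h * 24 + 23 ≤ x ∧ x ≤ G.h * 24 + 24)) :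
    x ∈ S.vertexDomU (S.clauseTarget z G) := by
  have hD : x ∈ S.domD (S.clause G) := mem_domD.2 ⟨G, rfl, h⟩
  rw [clauseTarget]
  split_ifs
  · exact hD
  · exact mem_domE.2 (Or.inl hD)

theorem mem_clauseU {G : H.UnitGraph} {x : ℤ}
    (h : x ∈ domD' (S.clause G) ∨ x ∈ domE' (S.clause G)) :
    x ∈ S.vertexDomU (S.clauseU G) := by
  rw [clauseU]
  split_ifs with hG
  · exact (mem_domA_pos hG).2 (Or.inr h)
  · exact (mem_domC_neg hG).2 (Or.inr h)

theorem matchingValue_mem_vertexDomU (hH : H.Balanced)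
    (hπ : ∀ i, litValue τ (H.lit i (w i)) = false → litValue τ (H.lit (π i) (w (π i))) = true)
    (v : H.Vertex) :
    S.matchingValue τ v ∈ S.vertexDomU (S.matching τ y z w π v) := by
  rcases v with ⟨G, c⟩ | i | i
  · obtain rfl | rfl | rfl : c = 0 ∨ c = 1 ∨ c = 2 := by fin_cases c <;> simp
    · rw [matchingValue, matching]
      split_ifs with h1 h2
      · exact mem_domB.2 (by omega)
      · exact mem_clauseTarget (Or.inl ⟨h2, by omega⟩)
      · have h3 := S.h_next_symm hH h2
        exact (mem_domC_pos ((S.isPositive_next_symm hH G).2 h2)).2 (by omega)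
    · rw [matchingValue, matching]
      split_ifs with h1
      · exact Finset.mem_union_left _ (by simp [t])
      · exact Finset.mem_union_left _ (by simp [t])
    · rw [matchingValue, matching]
      split_ifs with h1 h2
      · refine (mem_domA_neg fun h => (S.isPositive_next_symm hH G).1 h h2).2 (Or.inr ?_)
        rw [Equiv.apply_symm_apply]
        omega
      · exact mem_clauseTarget (Or.inr ⟨h2, by omega⟩)
      · exact mem_domB.2 (by omega)
  · rw [matchingValue, matching]
    refine mem_clauseU (Or.inl ?_)
    rw [clause_unitEquiv_symm, mem_domD']
    dsimp only
    omega
  · rw [matchingValue, matching]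
    split_ifs with h1
    · refine mem_clauseU (Or.inr ?_)
      rw [clause_unitEquiv_symm, mem_domE']
      dsimp only
      omega
    · refine mem_domE.2 (Or.inr ⟨i, fun h => ?_, mem_domE'.2 (by omega)⟩)
      have h2 := hπ i (Bool.eq_false_iff.2 h1)
      rw [← h] at h2
      exact h1 h2

theorem matchingValue_unit_le (G : H.UnitGraph) (c : Fin 3) :
    S.matchingValue τ (Sum.inl (G, c)) ≤ G.h * 24 + 23 := by
  obtain rfl | rfl | rfl : c = 0 ∨ c = 1 ∨ c = 2 := by fin_cases c <;> simp
  all_goals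
    rw [matchingValue]
    split_ifs <;> omega

theorem matchingValue_le (hH : H.Balanced) {v v' : H.Vertex}
    (h : (H.index v : ℕ) + 1 = H.index v') : S.matchingValue τ v ≤ S.matchingValue τ v' := by
  rcases v with ⟨G, c⟩ | i | i
  · have hG := G.h_lt
    rcases v' with ⟨G', c'⟩ | i' | i'
    · rw [coe_index_unit, coe_index_unit] at h
      have hc := c.isLt
      have hc' := c'.isLt
      obtain h1 | h1 : G.h = G'.h ∨ G.h + 1 = G'.h := by omega
      · obtain rfl := UnitGraph.h_injective h1
        obtain ⟨rfl, rfl⟩ | ⟨rfl, rfl⟩ : (c = 0 ∧ c' = 1) ∨ (c = 1 ∧ c' = 2) := by omega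
        all_goals
          rw [matchingValue, matchingValue]
          split_ifs <;> omega
      · obtain ⟨rfl, rfl⟩ : c = 2 ∧ c' = 0 := by omega
        by_cases hG' : S.IsPositive G'
        · rw [matchingValue, matchingValue]
          split_ifs <;> omega
        · -- A negative unit graph directly follows a unit graph of the same variable.
          have h2 := S.h_next_symm hH hG'
          obtain rfl : G = next.symm G' := UnitGraph.h_injective (by omega)
          rw [matchingValue, matchingValue]
          have h3 := (S.isPositive_next_symm hH G').2 hG'
          rw [next_symm_fst, if_pos h3, if_neg hG']
          split_ifs <;> omega
    · refine (matchingValue_unit_le G c).trans ?_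
      rw [matchingValue]
      omega
    · refine (matchingValue_unit_le G c).trans ?_
      rw [matchingValue]
      omega
  · rcases v' with ⟨G', c'⟩ | i' | i'
    · rw [coe_index_d, coe_index_unit] at h
      have := G'.h_lt
      omega
    · rw [coe_index_d, coe_index_d] at h
      rw [matchingValue, matchingValue]
      omega
    · rw [matchingValue, matchingValue]
      omega
  · rcases v' with ⟨G', c'⟩ | i' | i'
    · rw [coe_index_e, coe_index_unit] at h
      have := G'.h_lt
      omega
    · rw [coe_index_e, coe_index_d] at h
      omega
    · rw [coe_index_e, coe_index_e] at h
      rw [matchingValue, matchingValue]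
      omega

theorem matching_surjective (hH : H.Balanced)
    (hw : ∀ i s, s = y i ∨ s = z i ∨ s = w i) (hwz : ∀ i, w i ≠ z i)
    (hz : ∀ i, litValue τ (H.lit i (z i)) = false)
    (hπ : ∀ i', litValue τ (H.lit i' (w i')) = true →
        ∃ i, litValue τ (H.lit i (w i)) = false ∧ π i = i') :
    Function.Surjective (S.matching τ y z w π) := by
  have hU : ∀ G, litValue τ (H.lit (S.clause G) (S.place G)) = true →
      ∃ v, S.matching τ y z w π v = S.clauseU G := by
    intro G hG
    rcases hw (S.clause G) (S.place G) with h | h | h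
    · refine ⟨Sum.inr (Sum.inl (S.clause G)), ?_⟩
      rw [matching, ← h, unitEquiv_symm_clause_place]
    · rw [h, hz] at hG
      cases hG
    · refine ⟨Sum.inr (Sum.inr (S.clause G)), ?_⟩
      rw [matching, ← h, if_pos hG, unitEquiv_symm_clause_place]
  have hV : ∀ G, litValue τ (H.lit (S.clause G) (S.place G)) = false →
      ∃ v, S.matching τ y z w π v = S.clauseTarget z G := by
    intro G hG
    rw [← Bool.not_eq_true, litValue_eq_true_iff] at hG
    by_cases h : S.IsPositive G
    · exact ⟨Sum.inl (G, 0), by rw [matching, if_neg (by tauto), if_pos h]⟩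
    · exact ⟨Sum.inl (G, 2), by rw [matching, if_pos (by tauto), if_neg h]⟩
  rintro (⟨G, c⟩ | i | i)
  · obtain rfl | rfl | rfl : c = 0 ∨ c = 1 ∨ c = 2 := by fin_cases c <;> simp
    · by_cases h1 : τ G.1 = true
      · by_cases h2 : S.IsPositive G
        · obtain ⟨v, hv⟩ := hU G ((S.litValue_eq_true_iff τ G).2 (iff_of_true h2 h1))
          exact ⟨v, by rw [hv, clauseU, if_pos h2]⟩
        · refine ⟨Sum.inl (next G, 2), ?_⟩
          rw [matching, next_fst, if_pos h1, if_pos ((S.isPositive_next hH G).2 h2),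
            Equiv.symm_apply_apply]
      · exact ⟨Sum.inl (G, 1), by rw [matching, if_neg h1]⟩
    · by_cases h1 : τ G.1 = true
      · exact ⟨Sum.inl (G, 0), by rw [matching, if_pos h1]⟩
      · exact ⟨Sum.inl (G, 2), by rw [matching, if_neg h1]⟩
    · by_cases h1 : τ G.1 = true
      · exact ⟨Sum.inl (G, 1), by rw [matching, if_pos h1]⟩
      · by_cases h2 : S.IsPositive G
        · refine ⟨Sum.inl (next G, 0), ?_⟩
          rw [matching, next_fst, if_neg h1,
            if_neg fun h => (S.isPositive_next hH G).1 h h2, Equiv.symm_apply_apply]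
        · obtain ⟨v, hv⟩ := hU G ((S.litValue_eq_true_iff τ G).2 (iff_of_false h2 h1))
          exact ⟨v, by rw [hv, clauseU, if_neg h2]⟩
  · obtain ⟨v, hv⟩ := hV (S.unitEquiv.symm (i, z i)) (by simpa using hz i)
    exact ⟨v, by rw [hv, clauseTarget]; simp⟩
  · by_cases h1 : litValue τ (H.lit i (w i)) = true
    · obtain ⟨i', h2, rfl⟩ := hπ i h1
      exact ⟨Sum.inr (Sum.inr i'), by rw [matching, if_neg (by simp [h2])]⟩
    · obtain ⟨v, hv⟩ := hV (S.unitEquiv.symm (i, w i)) (by simpa using h1)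
      exact ⟨v, by rw [hv, clauseTarget]; simp [hwz i]⟩

theorem hasSortMatching_of_naeSatisfiable (S : H.AlternateOrder) (hH : H.Balanced)
    (h : H.NAESatisfiable) : HasSortMatching S.domU S.domV := by
  obtain ⟨τ, hτ⟩ := h
  choose hy hz using hτ
  choose y hy using hy
  choose z hz using hz
  have hyz : ∀ i, y i ≠ z i := by
    intro i h
    have := hy i
    rw [h, hz i] at this
    cases this
  have hthird : ∀ a b : Fin 3, a ≠ b → ∃ c, c ≠ a ∧ c ≠ b ∧ ∀ s, s = a ∨ s = b ∨ s = c := by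
    decide
  choose w hwy hwz hw using fun i => hthird _ _ (hyz i)
  obtain ⟨π, hπ, hπ'⟩ := exists_pairing hH τ hyz hwy hwz hy hz
  have hmem := fun v => And.intro (matchingValue_mem_vertexDomU (S := S) (y := y) (z := z) hH hπ v)
    (matchingValue_mem_vertexDomV (S := S) (τ := τ) v)
  have hsurj := matching_surjective (S := S) hH hw hwz hz hπ'
  exact S.hasSortMatching_iff.2 ⟨S.matching τ y z w π,
    ⟨Finite.injective_iff_surjective.2 hsurj, hsurj⟩, fun v => ⟨_, hmem v⟩,
    fun v v' hv => ⟨_, _, hmem v, hmem v', matchingValue_le hH hv⟩⟩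

end Formula.AlternateOrder

end SortSupport

theorem mainTheorem2 {k p : ℕ} (H : SortSupport.Formula k p) (hH : H.Balanced)
    (S : H.AlternateOrder) :
    H.NAESatisfiable ↔ SortSupport.HasSortMatching S.domU S.domV :=
  ⟨S.hasSortMatching_of_naeSatisfiable hH,
    SortSupport.Formula.AlternateOrder.naeSatisfiable_of_hasSortMatching hH⟩
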